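/- Let $E$ be a Euclidean space of dimension $\ell$ with inner product $(\cdot,\cdot)$, and let $\Phi$ be an irreducible crystallographic root system spanning $E$, not necessarily reduced (the empty root system in $E=\{0\}$ is allowed). Let $W$ be its Weyl group, $\Delta=\{\alpha_1,\dots,\alpha_\ell\}$ a set of simple roots, $\tilde\alpha=n_1\alpha_1+\cdots+n_\ell\alpha_\ell$ the highest root ($\tilde\alpha=0$ if $\Phi=\varnothing$), and $n_0=1$. Let $Z=\{x\in E : (\alpha,x)\in\mathbb Z \text{ for all } \alpha\in\Phi\}$ be the coweight lattice, $$A_\circ=\{x\in E : (\alpha_i,x)>0 \text{ for } 1\le i\le\ell,\ (\tilde\alpha,x)<1\}$$ the fundamental alcove, and $$P^\diamond=\{x\in E : 0<(\alpha_i,x)\le 1 \text{ for } 1\le i\le\ell\}$$ the fundamental parallelepiped. The projection $\pi_T:E\to T=E/Z$ restricts to a bijection $P^\diamond\to T$, through which the action of $W$ on $T$ given by $w\cdot\pi_T(x)=\pi_T(w(x))$ is transported to an action $\rho^\diamond$ of $W$ on $P^\diamond$. Let $W_{A_\circ}=\{w\in W : \rho^\diamond(w)(A_\circ)=A_\circ\}$.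 Put $J=\{j\in\{0,\dots,\ell\} : n_j=1\}$. Let $w_0$ be the longest element of $W$ with respect to the simple reflections, for $j\in J\setminus\{0\}$ let $w_j$ be the longest element of the subgroup of $W$ generated by the reflections in the roots of $\Delta\setminus\{\alpha_j\}$, and put $\omega_j=w_jw_0$ for $j\in J$ (so $\omega_0=w_0w_0=1$) and $\Omega=\{\omega_j : j\in J\}$. Then $W_{A_\circ}=\Omega$. Moreover $\Omega$ is also equal to the stabilizer $\{w\in W : w\cdot\pi_T(A_\circ)=\pi_T(A_\circ)\}$ of the image of $A_\circ$ in $T$, and to the image under the projection $Z\rtimes W\to W$ of the stabilizer of $A_\circ$ in the extended affine Weyl group $Z\rtimes W$, in which $(z,w)$ acts on $E$ by $x\mapsto w(x)+z$. -/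

import Mathlib

open scoped Pointwise InnerProductSpace

noncomputable section

namespace RootPairing

variable {ι E : Type*} [NormedAddCommGroup E] [InnerProductSpace ℝ E]

/-- A root pairing of a Euclidean space `E` with itself is Euclidean if the pairing is the inner
product and the coroot of `α` is `2α / (α, α)`. In particular the reflection attached to `α` is the
orthogonal reflection in the hyperplane `(α, x) = 0`. -/
class IsEuclidean (P : RootPairing ι ℝ E E) : Prop where
  toLinearMap_apply : ∀ x y : E, P.toLinearMap x y = ⟪x, y⟫_ℝ
  coroot_eq : ∀ i, P.coroot i = (2 / ⟪P.root i, P.root i⟫_ℝ) • P.root i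

/-- A set of simple roots `α₁, …, α_ℓ`: a basis of `E` made of roots such that every root is a
combination of it with coefficients all in `ℕ` or all in `-ℕ`. (Unlike `RootPairing.Base`, this is
the usual notion for non-reduced root systems too.) -/
structure SimpleRoots (P : RootPairing ι ℝ E E) (ℓ : ℕ) where
  /-- the indices of the simple roots -/
  idx : Fin ℓ → ι
  /-- the simple roots, as a basis of `E` -/
  basis : Module.Basis (Fin ℓ) ℝ E
  basis_apply : ∀ j, basis j = P.root (idx j)
  nonneg_or_nonpos : ∀ i, (∀ j, ∃ n : ℕ, basis.repr (P.root i) j = n) ∨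
    (∀ j, ∃ n : ℕ, basis.repr (P.root i) j = -n)

section Lattice

variable (P : RootPairing ι ℝ E E)

/-- The coweight lattice `Z`. -/
def coweightLattice : AddSubgroup E where
  carrier := {x | ∀ i, ∃ n : ℤ, ⟪P.root i, x⟫_ℝ = n}
  zero_mem' := fun i => ⟨0, by simp⟩
  add_mem' := by
    intro x y hx hy i
    obtain ⟨m, hm⟩ := hx i
    obtain ⟨n, hn⟩ := hy i
    exact ⟨m + n, by rw [inner_add_right, hm, hn]; push_cast; rfl⟩
  neg_mem' := by
    intro x hx i
    obtain ⟨m, hm⟩ := hx i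
    exact ⟨-m, by rw [inner_neg_right, hm]; push_cast; rfl⟩

variable [P.IsEuclidean]

theorem inner_weylGroup_smul (w : P.weylGroup) (x y : E) :
    ⟪w • x, w • y⟫_ℝ = ⟪x, y⟫_ℝ := by
  revert x y
  obtain ⟨g, hg⟩ := w
  induction hg using weylGroup.induction with
  | mem i =>
    intro x y
    have key : ∀ z : E, (⟨Equiv.reflection P i, P.reflection_mem_weylGroup i⟩ : P.weylGroup) • z =
        z - (2 / ⟪P.root i, P.root i⟫_ℝ * ⟪z, P.root i⟫_ℝ) • P.root i := by
      intro z
      change P.reflection i z = _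
      rw [reflection_apply]
      change z - (P.toLinearMap z (P.coroot i)) • P.root i = _
      rw [IsEuclidean.toLinearMap_apply, IsEuclidean.coroot_eq, inner_smul_right]
    have h0 : ⟪P.root i, P.root i⟫_ℝ ≠ 0 := by
      simpa using P.ne_zero i
    rw [key, key]
    simp only [inner_sub_left, inner_sub_right, inner_smul_left, inner_smul_right,
      real_inner_comm (P.root i) y, conj_trivial]
    field_simp
    rw [real_inner_comm y (P.root i)]
    ring
  | one => intro x y; rfl
  | mul g₁ g₂ hg₁ hg₂ h₁ h₂ =>
    intro x y
    rw [← Submonoid.mk_mul_mk _ _ _ hg₁ hg₂, mul_smul, mul_smul]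
    exact (h₁ _ _).trans (h₂ _ _)

theorem smul_mem_coweightLattice (w : P.weylGroup) {x : E} (hx : x ∈ P.coweightLattice) :
    w • x ∈ P.coweightLattice := by
  intro i
  obtain ⟨n, hn⟩ := hx (P.weylGroupToPerm w⁻¹ i)
  refine ⟨n, ?_⟩
  rw [← hn, ← weylGroup_apply_root, ← inner_weylGroup_smul P w (w⁻¹ • P.root i), smul_inv_smul]

/-- The action of the Weyl group `W` on `Z`. -/
instance instActionCoweight : DistribMulAction P.weylGroup P.coweightLattice where
  smul w z := ⟨w • (z : E), P.smul_mem_coweightLattice w z.2⟩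
  one_smul z := Subtype.ext (one_smul _ (z : E))
  mul_smul v w z := Subtype.ext (mul_smul v w (z : E))
  smul_zero w := Subtype.ext (smul_zero w)
  smul_add w y z := Subtype.ext (smul_add w (y : E) (z : E))

/-- The action of `W` on `Z`, as a homomorphism to the automorphism group of `Z` (written
multiplicatively). -/
def coweightAut : P.weylGroup →* MulAut (Multiplicative P.coweightLattice) where
  toFun w := AddEquiv.toMultiplicative (DistribMulAction.toAddEquiv P.coweightLattice w)
  map_one' := MulEquiv.ext fun z => one_smul P.weylGroup (Multiplicative.toAdd z)
  map_mul' v w := MulEquiv.ext fun z => mul_smul v w (Multiplicative.toAdd z)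

/-- The extended affine Weyl group `Z ⋊ W`. -/
abbrev ExtendedAffineWeylGroup : Type _ :=
  Multiplicative P.coweightLattice ⋊[P.coweightAut] P.weylGroup

/-- The element `(z, w)` of `Z ⋊ W` acts on `E` by `x ↦ w x + z`. -/
instance instActionExtended : MulAction P.ExtendedAffineWeylGroup E where
  smul g x := g.right • x + ((Multiplicative.toAdd g.left : P.coweightLattice) : E)
  one_smul x := by
    change (1 : P.weylGroup) • x + ((0 : P.coweightLattice) : E) = x
    simp
  mul_smul g h x := by
    change (g.right * h.right) • x + (((Multiplicative.toAdd g.left : P.coweightLattice) : E) +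
        g.right • ((Multiplicative.toAdd h.left : P.coweightLattice) : E)) =
      g.right • (h.right • x + ((Multiplicative.toAdd h.left : P.coweightLattice) : E)) +
        ((Multiplicative.toAdd g.left : P.coweightLattice) : E)
    rw [smul_add, mul_smul]
    abel

/-- The projection `π : Z ⋊ W → W`. -/
def projWeyl : P.ExtendedAffineWeylGroup →* P.weylGroup :=
  SemidirectProduct.rightHom

/-- The torus `T = E / Z`. -/
abbrev Torus : Type _ := E ⧸ P.coweightLattice

/-- The projection `π_T : E → T`. -/
abbrev toTorus (x : E) : P.Torus := QuotientAddGroup.mk x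

/-- The action `ρ_T` of `W` on `T`, induced by the action on `E`. -/
instance instActionTorus : MulAction P.weylGroup P.Torus where
  smul w := QuotientAddGroup.map P.coweightLattice P.coweightLattice
    (DistribSMul.toAddMonoidHom E w) (fun _ hx => P.smul_mem_coweightLattice w hx)
  one_smul t := by
    induction t using QuotientAddGroup.induction_on with
    | H x => exact congrArg P.toTorus (one_smul P.weylGroup x)
  mul_smul v w t := by
    induction t using QuotientAddGroup.induction_on with
    | H x => exact congrArg P.toTorus (mul_smul v w x)

end Lattice

end RootPairing

/-- Word length in a group with respect to a set `S` of generators that is closed under inversion: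
the least length of a list of elements of `S` with product `g`. (It is only used for `g` in the
subgroup generated by `S`.) -/
def wordLength {G : Type*} [Group G] (S : Set G) (g : G) : ℕ :=
  sInf {n | ∃ l : List G, l.length = n ∧ (∀ s ∈ l, s ∈ S) ∧ l.prod = g}

/-- `g` is a longest element of the group generated by `S`. -/
def IsLongestElement {G : Type*} [Group G] (S : Set G) (g : G) : Prop :=
  g ∈ Subgroup.closure S ∧ ∀ h ∈ Subgroup.closure S, wordLength S h ≤ wordLength S g

namespace RootPairing.SimpleRoots

variable {ι E : Type*} [NormedAddCommGroup E] [InnerProductSpace ℝ E]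
  {P : RootPairing ι ℝ E E} {ℓ : ℕ} (b : P.SimpleRoots ℓ)

open Classical in
/-- The highest root: the root whose coefficients on the simple roots are at least those of every
other root. For the empty root system (in the zero space) this is `0`. -/
def highestRoot : E :=
  if h : ∃ i, ∀ k j, b.basis.repr (P.root k) j ≤ b.basis.repr (P.root i) j then
    P.root h.choose else 0

/-- `n₀ = 1` and `n₁, …, n_ℓ` are the coefficients of the highest root. -/
def mark : Fin (ℓ + 1) → ℝ :=
  Fin.cons 1 (fun j => b.basis.repr b.highestRoot j)

/-- The index set `J` of all `j ∈ {0, …, ℓ}` with `n_j = 1`. -/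
def J : Set (Fin (ℓ + 1)) := {j | b.mark j = 1}

/-- The fundamental alcove. -/
def fundamentalAlcove : Set E :=
  {x | (∀ j, 0 < ⟪b.basis j, x⟫_ℝ) ∧ ⟪b.highestRoot, x⟫_ℝ < 1}

/-- The reflections in the simple roots other than `α_j`, where `j = k + 1` stands for the simple
root of index `k`; for `j = 0` these are all the simple reflections. -/
def simpleReflectionsOmitting (j : Fin (ℓ + 1)) : Set P.weylGroup :=
  {s | ∃ k : Fin ℓ, k.succ ≠ j ∧ s = weylGroup.ofIdx P (b.idx k)}

/-- The set `Ω` of the elements `ω_j = w_j w_0`, `j ∈ J`, where `w_0` is the longest element of `W`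
and `w_j` the longest element of the Weyl group of `Δ \ {α_j}` (so `ω_0 = w_0 w_0`). -/
def Omega : Set P.weylGroup :=
  {ω | ∃ j ∈ b.J, ∃ wj w0 : P.weylGroup,
    IsLongestElement (b.simpleReflectionsOmitting j) wj ∧
    IsLongestElement (b.simpleReflectionsOmitting 0) w0 ∧ ω = wj * w0}

/-- The fundamental parallelepiped `P^⋄` of `Z`. -/
def parallelepiped : Set E :=
  {x | ∀ j, 0 < ⟪b.basis j, x⟫_ℝ ∧ ⟪b.basis j, x⟫_ℝ ≤ 1}

theorem mem_coweightLattice_of_basis {x : E}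
    (hx : ∀ j, ∃ n : ℤ, ⟪b.basis j, x⟫_ℝ = n) : x ∈ P.coweightLattice := by
  intro i
  choose f hf using hx
  have hc : ∀ j, ∃ n : ℤ, b.basis.repr (P.root i) j = n := by
    rcases b.nonneg_or_nonpos i with h | h
    · exact fun j => (h j).elim fun n hn => ⟨n, by rw [hn]; norm_cast⟩
    · exact fun j => (h j).elim fun n hn => ⟨-n, by rw [hn]; push_cast; rfl⟩
  choose c hc using hc
  refine ⟨∑ j, c j * f j, ?_⟩
  rw [← b.basis.sum_repr (P.root i), sum_inner]
  push_cast
  exact Finset.sum_congr rfl fun j _ => by rw [real_inner_smul_left, hc, hf]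

theorem exists_inner_basis (c : Fin ℓ → ℝ) : ∃ x : E, ∀ j, ⟪b.basis j, x⟫_ℝ = c j := by
  have : FiniteDimensional ℝ E := b.basis.finiteDimensional_of_finite
  refine ⟨(InnerProductSpace.toDual ℝ E).symm
    (LinearMap.toContinuousLinearMap (b.basis.constr ℝ c)), fun j => ?_⟩
  rw [real_inner_comm, InnerProductSpace.toDual_symm_apply]
  simp

/-- The restriction of `π_T` to `P^⋄` is a bijection onto `T`. -/
theorem bijective_toTorus :
    Function.Bijective (fun x : b.parallelepiped => P.toTorus (x : E)) := by
  constructor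
  · rintro ⟨x, hx⟩ ⟨y, hy⟩ hxy
    have hz : -x + y ∈ P.coweightLattice := QuotientAddGroup.eq.mp hxy
    apply Subtype.ext
    refine InnerProductSpace.ext_inner_left_basis b.basis fun j => ?_
    obtain ⟨n, hn⟩ := hz (b.idx j)
    rw [← b.basis_apply, inner_add_right, inner_neg_right] at hn
    have h1 := hx j
    have h2 := hy j
    have hlt : (n : ℝ) < 1 := by linarith [h1.1, h2.2]
    have hgt : (-1 : ℝ) < n := by linarith [h1.2, h2.1]
    have hlt' : n < 1 := by exact_mod_cast hlt
    have hgt' : -1 < n := by exact_mod_cast hgt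
    have h0 : n = 0 := by omega
    rw [h0] at hn
    push_cast at hn
    change ⟪b.basis j, x⟫_ℝ = ⟪b.basis j, y⟫_ℝ
    linarith
  · intro t
    induction t using QuotientAddGroup.induction_on with
    | H x =>
      obtain ⟨z, hz⟩ := b.exists_inner_basis (fun j => 1 - (⌈⟪b.basis j, x⟫_ℝ⌉ : ℝ))
      have hzZ : z ∈ P.coweightLattice :=
        b.mem_coweightLattice_of_basis fun j => ⟨1 - ⌈⟪b.basis j, x⟫_ℝ⌉, by rw [hz]; push_cast; rfl⟩
      refine ⟨⟨x + z, fun j => ?_⟩, ?_⟩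
      · rw [inner_add_right, hz]
        constructor
        · linarith [Int.ceil_lt_add_one ⟪b.basis j, x⟫_ℝ]
        · linarith [Int.le_ceil ⟪b.basis j, x⟫_ℝ]
      · refine (QuotientAddGroup.eq.mpr ?_)
        simpa using hzZ

/-- The bijection from `P^⋄` to `T` obtained by restricting `π_T`. -/
def parallelepipedEquiv : b.parallelepiped ≃ P.Torus :=
  Equiv.ofBijective _ b.bijective_toTorus

variable [P.IsEuclidean]

/-- The action `ρ^⋄` of `W` on `P^⋄`, transported from the action on `T`. -/
def rho (w : P.weylGroup) (x : b.parallelepiped) : b.parallelepiped :=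
  b.parallelepipedEquiv.symm (w • b.parallelepipedEquiv x)

/-- The stabilizer `W_C` of a subset `C` of `P^⋄` under `ρ^⋄`. -/
def stabilizer (C : Set E) : Set P.weylGroup :=
  {w | (fun x : b.parallelepiped => (b.rho w x : E)) '' {x | (x : E) ∈ C} = C}

end RootPairing.SimpleRoots

end

/-! For `x ∈ A_∘`, the point `w x + z` lies in `A_∘` iff `z` pairs to `1` with the positive roots
that `w⁻¹` makes negative and to `0` with the other positive roots. This does not involve `x`, so
`A_∘` is a block for `Z ⋊ W`, and its stabilizers in `W` (acting on `P^⋄` or on `T`) and in `Z ⋊ W`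
correspond to each other. Since the highest root pairs to at most `1` with such a `z` and has
coefficients at least `1`, `z` is `0` or a fundamental coweight `ϖ_j` with `j ∈ J`. On the other
hand `w_j` makes negative exactly the positive roots orthogonal to `ϖ_j`, and `w_0` all positive
roots, so `w_j w_0` satisfies the condition for `z = ϖ_j`; and it is the only such element because
an element of `W` is determined by the set of positive roots it makes negative. -/

theorem add_intCast_mem_Ioo_zero_one_iff {t : ℝ} (ht : t ∈ Set.Ioo 0 1) (m : ℤ) :
    t + m ∈ Set.Ioo 0 1 ↔ m = 0 := by
  refine ⟨fun h => ?_, fun h => by rwa [h, Int.cast_zero, add_zero]⟩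
  have hlt : (m : ℝ) < 1 := by linarith [ht.1, h.2]
  have hgt : (-1 : ℝ) < m := by linarith [ht.2, h.1]
  have hlt' : m < 1 := mod_cast hlt
  have hgt' : -1 < m := mod_cast hgt
  lia

section General

variable {ι R M N : Type*} [CommRing R] [AddCommGroup M] [Module R M] [AddCommGroup N] [Module R N]
  {P : RootPairing ι R M N}

theorem weylGroup_ext {v w : P.weylGroup} (h : ∀ x : M, v • x = w • x) : v = w :=
  Subtype.ext <| RootPairing.Equiv.weightHom_injective P <| LinearEquiv.ext h

theorem weylGroup_smul_mem_range_root (w : P.weylGroup) {v : M} (hv : v ∈ Set.range P.root) :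
    w • v ∈ Set.range P.root := by
  obtain ⟨i, rfl⟩ := hv
  exact ⟨_, (P.weylGroup_apply_root w i).symm⟩

variable (P) in
theorem inv_ofIdx (i : ι) :
    (RootPairing.weylGroup.ofIdx P i)⁻¹ = RootPairing.weylGroup.ofIdx P i :=
  Subtype.ext (RootPairing.Equiv.reflection_inv P i)

variable (P) in
theorem ofIdx_mul_self (i : ι) :
    RootPairing.weylGroup.ofIdx P i * RootPairing.weylGroup.ofIdx P i = 1 := by
  rw [mul_eq_one_iff_inv_eq, inv_ofIdx]

end General

section WordLength

variable {G : Type*} [Group G] {S : Set G}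

theorem exists_list_length_eq_wordLength (hS : ∀ s ∈ S, s⁻¹ ∈ S) {g : G}
    (hg : g ∈ Subgroup.closure S) :
    ∃ l : List G, l.length = wordLength S g ∧ (∀ s ∈ l, s ∈ S) ∧ l.prod = g := by
  rw [← Subgroup.mem_toSubmonoid, Subgroup.closure_toSubmonoid] at hg
  obtain ⟨l, hl, hlg⟩ := Submonoid.exists_list_of_mem_closure hg
  have hlS : ∀ s ∈ l, s ∈ S := fun s hs =>
    (hl s hs).elim id fun h => by simpa only [inv_inv] using hS _ h
  exact Nat.sInf_mem (s := {n | ∃ l : List G, l.length = n ∧ (∀ s ∈ l, s ∈ S) ∧ l.prod = g})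
    ⟨l.length, l, rfl, hlS, hlg⟩

theorem wordLength_prod_le {l : List G} (hl : ∀ s ∈ l, s ∈ S) :
    wordLength S l.prod ≤ l.length :=
  Nat.sInf_le ⟨l, rfl, hl, rfl⟩

theorem exists_wordLength_mul_inv_lt (hS : ∀ s ∈ S, s⁻¹ ∈ S) {g : G}
    (hg : g ∈ Subgroup.closure S) (hne : g ≠ 1) :
    ∃ s ∈ S, wordLength S (g * s⁻¹) < wordLength S g := by
  obtain ⟨l, hlen, hlS, rfl⟩ := exists_list_length_eq_wordLength hS hg
  rcases l.eq_nil_or_concat with rfl | ⟨l, s, rfl⟩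
  · exact absurd List.prod_nil hne
  · rw [List.concat_eq_append] at hlen hlS ⊢
    simp only [List.forall_mem_append, List.forall_mem_singleton] at hlS
    refine ⟨s, hlS.2, ?_⟩
    rw [← hlen, List.length_append, List.length_singleton, Nat.lt_succ_iff, List.prod_append,
      List.prod_singleton, mul_inv_cancel_right]
    exact wordLength_prod_le hlS.1

theorem wordLength_inv_le (hS : ∀ s ∈ S, s⁻¹ ∈ S) {g : G} (hg : g ∈ Subgroup.closure S) :
    wordLength S g⁻¹ ≤ wordLength S g := by
  obtain ⟨l, hlen, hlS, rfl⟩ := exists_list_length_eq_wordLength hS hg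
  have hinv : ∀ s ∈ (l.map (·⁻¹)).reverse, s ∈ S := by
    simpa only [List.mem_reverse, List.forall_mem_map] using fun s hs => hS s (hlS s hs)
  calc wordLength S l.prod⁻¹ = wordLength S (l.map (·⁻¹)).reverse.prod := by
        rw [List.prod_inv_reverse]
    _ ≤ (l.map (·⁻¹)).reverse.length := wordLength_prod_le hinv
    _ = wordLength S l.prod := by rw [List.length_reverse, List.length_map, hlen]

theorem IsLongestElement.inv (hS : ∀ s ∈ S, s⁻¹ ∈ S) {g : G} (hg : IsLongestElement S g) :
    IsLongestElement S g⁻¹ :=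
  ⟨inv_mem hg.1, fun h hh => (hg.2 h hh).trans <| by
    simpa only [inv_inv] using wordLength_inv_le hS (inv_mem hg.1)⟩

theorem exists_isLongestElement [Finite G] (S : Set G) : ∃ g, IsLongestElement S g := by
  obtain ⟨g, hg, h⟩ := Set.exists_max_image (Subgroup.closure S : Set G) (wordLength S)
    (Set.toFinite _) ⟨1, one_mem _⟩
  exact ⟨g, hg, h⟩

end WordLength

namespace RootPairing.IsEuclidean

variable {ι E : Type*} [NormedAddCommGroup E] [InnerProductSpace ℝ E]
  {P : RootPairing ι ℝ E E} [P.IsEuclidean]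

theorem pairing_eq_inner (i j : ι) :
    P.pairing i j = 2 / ⟪P.root j, P.root j⟫_ℝ * ⟪P.root i, P.root j⟫_ℝ := by
  rw [← root_coroot_eq_pairing, toLinearMap_apply, coroot_eq, inner_smul_right]

theorem ofIdx_smul (i : ι) (x : E) :
    weylGroup.ofIdx P i • x =
      x - (2 / ⟪P.root i, P.root i⟫_ℝ * ⟪x, P.root i⟫_ℝ) • P.root i := by
  change x - P.toLinearMap x (P.coroot i) • P.root i = _
  rw [toLinearMap_apply, coroot_eq, inner_smul_right]

theorem inner_weylGroup_smul_right (w : P.weylGroup) (x y : E) :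
    ⟪x, w • y⟫_ℝ = ⟪w⁻¹ • x, y⟫_ℝ := by
  rw [← P.inner_weylGroup_smul w (w⁻¹ • x), smul_inv_smul]

theorem conj_ofIdx_of_smul_root (w : P.weylGroup) {i j : ι} {c : ℝ}
    (h : w • P.root i = c • P.root j) :
    w * weylGroup.ofIdx P i * w⁻¹ = weylGroup.ofIdx P j := by
  have hc : c ≠ 0 := by
    rintro rfl
    rw [zero_smul, weylGroup_apply_root] at h
    exact P.ne_zero _ h
  have hj : ⟪P.root j, P.root j⟫_ℝ ≠ 0 := inner_self_ne_zero.2 (P.ne_zero j)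
  refine weylGroup_ext fun x => ?_
  have hnorm : ⟪P.root i, P.root i⟫_ℝ = c * c * ⟪P.root j, P.root j⟫_ℝ := by
    rw [← P.inner_weylGroup_smul w, h, real_inner_smul_left, real_inner_smul_right, mul_assoc]
  have hinner : ⟪w⁻¹ • x, P.root i⟫_ℝ = c * ⟪x, P.root j⟫_ℝ := by
    rw [← P.inner_weylGroup_smul w, h, smul_inv_smul, real_inner_smul_right]
  rw [mul_smul, mul_smul, ofIdx_smul, smul_sub, smul_inv_smul, smul_comm w, h, ofIdx_smul, hnorm,
    hinner, smul_smul]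
  congr 2
  field_simp

end RootPairing.IsEuclidean

namespace RootPairing.SimpleRoots

variable {ι E : Type*} [NormedAddCommGroup E] [InnerProductSpace ℝ E]
  {P : RootPairing ι ℝ E E} {ℓ : ℕ}

section PositiveRoots

variable (b : P.SimpleRoots ℓ)

/-- Positive roots, as vectors rather than indices, so that the Weyl group acts on them directly. -/
def IsPos (v : E) : Prop := v ∈ Set.range P.root ∧ ∀ j, 0 ≤ b.basis.repr v j

/-- The simple reflection `s_k`, as an element of the Weyl group. -/
noncomputable abbrev simpleReflection (k : Fin ℓ) : P.weylGroup := weylGroup.ofIdx P (b.idx k)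

/-- The height of a vector, i.e. the sum of its coefficients on the simple roots. -/
noncomputable def height : E →ₗ[ℝ] ℝ := b.basis.constr ℝ fun _ => 1

variable {b}

theorem basis_mem_range_root (k : Fin ℓ) : b.basis k ∈ Set.range P.root :=
  ⟨_, (b.basis_apply k).symm⟩

theorem exists_int_repr {v : E} (hv : v ∈ Set.range P.root) (j : Fin ℓ) :
    ∃ n : ℤ, b.basis.repr v j = n := by
  obtain ⟨i, rfl⟩ := hv
  rcases b.nonneg_or_nonpos i with h | h
  · obtain ⟨n, hn⟩ := h j
    exact ⟨n, mod_cast hn⟩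
  · obtain ⟨n, hn⟩ := h j
    exact ⟨-n, mod_cast hn⟩

theorem isPos_or_isPos_neg {v : E} (hv : v ∈ Set.range P.root) : b.IsPos v ∨ b.IsPos (-v) := by
  obtain ⟨i, rfl⟩ := hv
  refine (b.nonneg_or_nonpos i).imp (fun h => ⟨⟨i, rfl⟩, fun j => ?_⟩)
    fun h => ⟨P.neg_mem_range_root_iff.2 ⟨i, rfl⟩, fun j => ?_⟩
  · obtain ⟨n, hn⟩ := h j
    simp only [hn, Nat.cast_nonneg]
  · obtain ⟨n, hn⟩ := h j
    simp only [map_neg, Finsupp.neg_apply, hn, neg_neg, Nat.cast_nonneg]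

theorem IsPos.ne_zero {v : E} (hv : b.IsPos v) : v ≠ 0 := by
  obtain ⟨⟨i, rfl⟩, -⟩ := hv
  exact P.ne_zero i

theorem isPos_neg_iff {v : E} (hv : v ∈ Set.range P.root) : b.IsPos (-v) ↔ ¬ b.IsPos v := by
  refine ⟨fun hneg hpos => hpos.ne_zero (b.basis.ext_elem fun j => ?_),
    (isPos_or_isPos_neg hv).resolve_left⟩
  have hj := hneg.2 j
  rw [map_neg, Finsupp.neg_apply, neg_nonneg] at hj
  rw [map_zero, Finsupp.zero_apply]
  exact le_antisymm hj (hpos.2 j)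

theorem isPos_of_repr_pos {v : E} (hv : v ∈ Set.range P.root) {j : Fin ℓ}
    (h : 0 < b.basis.repr v j) : b.IsPos v := by
  refine (isPos_or_isPos_neg hv).resolve_right fun hneg => h.not_ge ?_
  simpa only [map_neg, Finsupp.neg_apply, neg_nonneg] using hneg.2 j

theorem isPos_basis (k : Fin ℓ) : b.IsPos (b.basis k) :=
  isPos_of_repr_pos (basis_mem_range_root k) (j := k) (by simp)

theorem IsPos.exists_repr_pos {v : E} (hv : b.IsPos v) : ∃ j, 0 < b.basis.repr v j := by
  by_contra! h
  exact hv.ne_zero (b.basis.ext_elem fun j => by simpa using le_antisymm (h j) (hv.2 j))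

theorem IsPos.exists_nat_height {v : E} (hv : b.IsPos v) : ∃ n : ℕ, b.height v = n := by
  have hrepr : ∀ j, ∃ n : ℕ, b.basis.repr v j = n := fun j => by
    obtain ⟨n, hn⟩ := exists_int_repr hv.1 j
    have hn0 : (0 : ℝ) ≤ n := hn ▸ hv.2 j
    lift n to ℕ using mod_cast hn0
    exact ⟨n, mod_cast hn⟩
  choose n hn using hrepr
  refine ⟨∑ j, n j, ?_⟩
  rw [height, Module.Basis.constr_apply_fintype, Nat.cast_sum]
  exact Finset.sum_congr rfl fun j _ => by
    rw [Module.Basis.equivFun_apply, hn, smul_eq_mul, mul_one]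

theorem inner_eq_sum_repr (v x : E) :
    ⟪v, x⟫_ℝ = ∑ j, b.basis.repr v j * ⟪b.basis j, x⟫_ℝ := by
  conv_lhs => rw [← b.basis.sum_repr v, sum_inner]
  simp only [real_inner_smul_left]

theorem IsPos.inner_nonneg {v x : E} (hv : b.IsPos v) (hx : ∀ j, 0 ≤ ⟪b.basis j, x⟫_ℝ) :
    0 ≤ ⟪v, x⟫_ℝ := by
  rw [inner_eq_sum_repr (b := b)]
  exact Finset.sum_nonneg fun j _ => mul_nonneg (hv.2 j) (hx j)

theorem IsPos.inner_pos {v x : E} (hv : b.IsPos v) (hx : ∀ j, 0 < ⟪b.basis j, x⟫_ℝ) :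
    0 < ⟪v, x⟫_ℝ := by
  obtain ⟨k, hk⟩ := hv.exists_repr_pos
  rw [inner_eq_sum_repr (b := b)]
  exact Finset.sum_pos' (fun j _ => mul_nonneg (hv.2 j) (hx j).le)
    ⟨k, Finset.mem_univ k, mul_pos hk (hx k)⟩

theorem IsPos.exists_inner_basis_pos {v : E} (hv : b.IsPos v) : ∃ k, 0 < ⟪v, b.basis k⟫_ℝ := by
  by_contra! h
  have hneg : 0 ≤ ⟪v, -v⟫_ℝ := hv.inner_nonneg fun j => by
    rw [inner_neg_right, real_inner_comm, neg_nonneg]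
    exact h j
  rw [inner_neg_right, neg_nonneg] at hneg
  exact (real_inner_self_pos.2 hv.ne_zero).not_ge hneg

theorem two_div_inner_basis_self_pos (k : Fin ℓ) : 0 < 2 / ⟪b.basis k, b.basis k⟫_ℝ :=
  div_pos two_pos (real_inner_self_pos.2 (b.basis.ne_zero k))

theorem inv_mem_of_subset_range_simpleReflection {S : Set P.weylGroup}
    (hS : S ⊆ Set.range b.simpleReflection) : ∀ s ∈ S, s⁻¹ ∈ S := by
  intro s hs
  obtain ⟨k, rfl⟩ := hS hs
  rwa [inv_ofIdx]

end PositiveRoots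

section SimpleReflections

variable {b : P.SimpleRoots ℓ} [P.IsEuclidean]

theorem simpleReflection_smul (k : Fin ℓ) (x : E) : b.simpleReflection k • x =
    x - (2 / ⟪b.basis k, b.basis k⟫_ℝ * ⟪x, b.basis k⟫_ℝ) • b.basis k := by
  rw [b.basis_apply, IsEuclidean.ofIdx_smul]

theorem simpleReflection_smul_self (k : Fin ℓ) :
    b.simpleReflection k • b.basis k = -b.basis k := by
  rw [simpleReflection_smul, div_mul_cancel₀ _ (inner_self_ne_zero.2 (b.basis.ne_zero k))]
  module

theorem repr_simpleReflection_smul_of_ne {k j : Fin ℓ} (h : j ≠ k) (x : E) :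
    b.basis.repr (b.simpleReflection k • x) j = b.basis.repr x j := by
  rw [simpleReflection_smul]
  simp [h.symm]

theorem repr_simpleReflection_smul_self (k : Fin ℓ) (x : E) :
    b.basis.repr (b.simpleReflection k • x) k =
      b.basis.repr x k - 2 / ⟪b.basis k, b.basis k⟫_ℝ * ⟪x, b.basis k⟫_ℝ := by
  rw [simpleReflection_smul]
  simp

theorem height_simpleReflection_smul (k : Fin ℓ) (x : E) :
    b.height (b.simpleReflection k • x) =
      b.height x - 2 / ⟪b.basis k, b.basis k⟫_ℝ * ⟪x, b.basis k⟫_ℝ := by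
  rw [simpleReflection_smul, map_sub, map_smul, height, Module.Basis.constr_basis, smul_eq_mul,
    mul_one]

theorem IsPos.simpleReflection_smul_or {v : E} (hv : b.IsPos v) (k : Fin ℓ) :
    b.IsPos (b.simpleReflection k • v) ∨ v = b.basis.repr v k • b.basis k := by
  by_cases h : ∃ j ≠ k, 0 < b.basis.repr v j
  · obtain ⟨j, hj, hpos⟩ := h
    refine .inl (isPos_of_repr_pos (weylGroup_smul_mem_range_root _ hv.1) (j := j) ?_)
    rwa [repr_simpleReflection_smul_of_ne hj]
  · push Not at h
    refine .inr (b.basis.ext_elem fun j => ?_)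
    rcases eq_or_ne j k with rfl | hj
    · simp
    · simpa [Finsupp.single_apply, hj.symm] using le_antisymm (h j hj) (hv.2 j)

/-- Conjugation by the simple reflections lowers the height of a positive root until it becomes a
multiple of a simple root. -/
theorem IsPos.exists_smul_basis {v : E} (hv : b.IsPos v) :
    ∃ w ∈ Subgroup.closure (Set.range b.simpleReflection), ∃ (k : Fin ℓ) (c : ℝ),
      w • b.basis k = c • v := by
  obtain ⟨n, hn⟩ := hv.exists_nat_height
  induction n using Nat.strong_induction_on generalizing v with
  | _ n ih =>
    obtain ⟨k, hk⟩ := hv.exists_inner_basis_pos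
    rcases hv.simpleReflection_smul_or k with hpos | hmul
    · obtain ⟨m, hm⟩ := hpos.exists_nat_height
      have hlt : m < n := by
        rw [← @Nat.cast_lt ℝ, ← hm, ← hn, height_simpleReflection_smul, sub_lt_self_iff]
        exact mul_pos (two_div_inner_basis_self_pos k) hk
      obtain ⟨w, hw, k', c, hc⟩ := ih m hlt hpos hm
      refine ⟨b.simpleReflection k * w, mul_mem (Subgroup.subset_closure ⟨k, rfl⟩) hw, k', c, ?_⟩
      rw [mul_smul, hc, smul_comm, ← mul_smul, ofIdx_mul_self, one_smul]
    · have hne : b.basis.repr v k ≠ 0 := fun h0 => hv.ne_zero <| by rw [hmul, h0, zero_smul]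
      refine ⟨1, one_mem _, k, (b.basis.repr v k)⁻¹, ?_⟩
      rw [one_smul, eq_inv_smul_iff₀ hne]
      exact hmul.symm

theorem ofIdx_mem_closure_range_simpleReflection (i : ι) :
    weylGroup.ofIdx P i ∈ Subgroup.closure (Set.range b.simpleReflection) := by
  have hconj : ∃ w ∈ Subgroup.closure (Set.range b.simpleReflection), ∃ (k : Fin ℓ) (c : ℝ),
      w • b.basis k = c • P.root i := by
    rcases isPos_or_isPos_neg (b := b) ⟨i, rfl⟩ with h | h
    · exact h.exists_smul_basis
    · obtain ⟨w, hw, k, c, hc⟩ := h.exists_smul_basis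
      exact ⟨w, hw, k, -c, by rw [hc, smul_neg, neg_smul]⟩
  obtain ⟨w, hw, k, c, hc⟩ := hconj
  rw [b.basis_apply] at hc
  rw [← IsEuclidean.conj_ofIdx_of_smul_root w hc]
  exact mul_mem (mul_mem hw (Subgroup.subset_closure ⟨k, rfl⟩)) (inv_mem hw)

theorem closure_range_simpleReflection : Subgroup.closure (Set.range b.simpleReflection) = ⊤ := by
  rw [eq_top_iff]
  rintro ⟨g, hg⟩ -
  induction hg using weylGroup.induction with
  | mem i => exact ofIdx_mem_closure_range_simpleReflection i
  | one => exact one_mem _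
  | mul _ _ _ _ hx hy => exact mul_mem hx hy

theorem exchange_property {S : Set P.weylGroup} (hS : S ⊆ Set.range b.simpleReflection)
    (k : Fin ℓ) (l : List P.weylGroup) (hl : ∀ s ∈ l, s ∈ S)
    (h : ¬ b.IsPos (l.prod • b.basis k)) :
    ∃ l' : List P.weylGroup, l'.length + 1 = l.length ∧ (∀ s ∈ l', s ∈ S) ∧
      l'.prod = l.prod * b.simpleReflection k := by
  induction l with
  | nil => exact absurd (by simpa using isPos_basis k) h
  | cons s l ih =>
    rw [List.forall_mem_cons] at hl
    by_cases hpos : b.IsPos (l.prod • b.basis k)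
    · obtain ⟨i, rfl⟩ := hS hl.1
      rw [List.prod_cons, mul_smul] at h
      have hmul := (hpos.simpleReflection_smul_or i).resolve_left h
      rw [b.basis_apply, b.basis_apply] at hmul
      have hcomm : l.prod * b.simpleReflection k = b.simpleReflection i * l.prod :=
        mul_inv_eq_iff_eq_mul.1 (IsEuclidean.conj_ofIdx_of_smul_root _ hmul)
      refine ⟨l, rfl, hl.2, ?_⟩
      rw [List.prod_cons, mul_assoc, hcomm, ← mul_assoc, ofIdx_mul_self, one_mul]
    · obtain ⟨l', hlen, hl', hprod⟩ := ih hl.2 hpos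
      refine ⟨s :: l', by simp [hlen], List.forall_mem_cons.2 ⟨hl.1, hl'⟩, ?_⟩
      rw [List.prod_cons, hprod, List.prod_cons, mul_assoc]

theorem wordLength_lt_mul_simpleReflection {S : Set P.weylGroup}
    (hS : S ⊆ Set.range b.simpleReflection) {w : P.weylGroup} (hw : w ∈ Subgroup.closure S)
    {k : Fin ℓ} (hk : b.simpleReflection k ∈ S) (h : b.IsPos (w • b.basis k)) :
    wordLength S w < wordLength S (w * b.simpleReflection k) := by
  obtain ⟨l, hlen, hl, hprod⟩ := exists_list_length_eq_wordLength
    (inv_mem_of_subset_range_simpleReflection hS) (mul_mem hw (Subgroup.subset_closure hk))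
  have hneg : ¬ b.IsPos (l.prod • b.basis k) := by
    rw [hprod, mul_smul, simpleReflection_smul_self, smul_neg, isPos_neg_iff h.1, not_not]
    exact h
  obtain ⟨l', hlen', hl', hprod'⟩ := exchange_property hS k l hl hneg
  rw [hprod, mul_assoc, ofIdx_mul_self, mul_one] at hprod'
  rw [← hlen, ← hlen', ← hprod', Nat.lt_succ_iff]
  exact wordLength_prod_le hl'

theorem eq_one_of_forall_isPos_smul_basis {w : P.weylGroup}
    (h : ∀ k, b.IsPos (w • b.basis k)) : w = 1 := by
  by_contra hne
  have hmem : w ∈ Subgroup.closure (Set.range b.simpleReflection) := by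
    rw [closure_range_simpleReflection]
    exact Subgroup.mem_top w
  obtain ⟨_, ⟨k, rfl⟩, hlt⟩ := exists_wordLength_mul_inv_lt
    (inv_mem_of_subset_range_simpleReflection subset_rfl) hmem hne
  rw [inv_ofIdx] at hlt
  exact hlt.not_gt (wordLength_lt_mul_simpleReflection subset_rfl hmem ⟨k, rfl⟩ (h k))

theorem eq_of_forall_isPos_smul_iff {v w : P.weylGroup}
    (h : ∀ x, b.IsPos x → (b.IsPos (v • x) ↔ b.IsPos (w • x))) : v = w := by
  have hroot : ∀ x ∈ Set.range P.root, b.IsPos (w • x) → b.IsPos (v • x) := fun x hx hwx => by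
    rcases isPos_or_isPos_neg hx with hpos | hneg
    · exact (h x hpos).2 hwx
    · have := h _ hneg
      rw [smul_neg, smul_neg, isPos_neg_iff (weylGroup_smul_mem_range_root v hx),
        isPos_neg_iff (weylGroup_smul_mem_range_root w hx), not_iff_not] at this
      exact this.2 hwx
  rw [← mul_inv_eq_one]
  refine eq_one_of_forall_isPos_smul_basis (b := b) fun k => ?_
  rw [mul_smul]
  refine hroot _ (weylGroup_smul_mem_range_root _ (basis_mem_range_root k)) ?_
  rw [smul_inv_smul]
  exact isPos_basis k

theorem finite_weylGroup [Finite ι] (b : P.SimpleRoots ℓ) : Finite P.weylGroup :=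
  Finite.of_injective (fun w : P.weylGroup => {i | b.IsPos (w • P.root i)}) fun v w hvw =>
    eq_of_forall_isPos_smul_iff (b := b) <| by
      rintro _ ⟨⟨i, rfl⟩, -⟩
      exact Set.ext_iff.1 hvw i

end SimpleReflections

section FundamentalCoweights

variable (b : P.SimpleRoots ℓ)

/-- The fundamental coweights: `fundamentalCoweight 0 = 0`, and for `j = k + 1` the vector dual to
the simple root of index `k`. The shift matches the indexing of `mark` and `J`. -/
noncomputable def fundamentalCoweight (j : Fin (ℓ + 1)) : E :=
  (b.exists_inner_basis fun i => if i.succ = j then 1 else 0).choose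

variable {b}

theorem inner_basis_fundamentalCoweight (i : Fin ℓ) (j : Fin (ℓ + 1)) :
    ⟪b.basis i, b.fundamentalCoweight j⟫_ℝ = if i.succ = j then 1 else 0 :=
  (b.exists_inner_basis fun i => if i.succ = j then 1 else 0).choose_spec i

theorem eq_fundamentalCoweight {z : E} {j : Fin (ℓ + 1)}
    (hz : ∀ i : Fin ℓ, ⟪b.basis i, z⟫_ℝ = if i.succ = j then 1 else 0) :
    z = b.fundamentalCoweight j :=
  InnerProductSpace.ext_inner_left_basis b.basis fun i => by
    rw [hz, inner_basis_fundamentalCoweight]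

theorem inner_fundamentalCoweight_zero (v : E) : ⟪v, b.fundamentalCoweight 0⟫_ℝ = 0 := by
  rw [inner_eq_sum_repr (b := b)]
  simp [inner_basis_fundamentalCoweight, Fin.succ_ne_zero]

theorem inner_fundamentalCoweight_succ (v : E) (k : Fin ℓ) :
    ⟪v, b.fundamentalCoweight k.succ⟫_ℝ = b.basis.repr v k := by
  rw [inner_eq_sum_repr (b := b)]
  simp [inner_basis_fundamentalCoweight]

theorem IsPos.inner_fundamentalCoweight_nonneg {v : E} (hv : b.IsPos v) (j : Fin (ℓ + 1)) :
    0 ≤ ⟪v, b.fundamentalCoweight j⟫_ℝ :=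
  hv.inner_nonneg fun i => by rw [inner_basis_fundamentalCoweight]; split_ifs <;> norm_num

theorem isPos_of_inner_fundamentalCoweight_pos {v : E} (hv : v ∈ Set.range P.root)
    {j : Fin (ℓ + 1)} (h : 0 < ⟪v, b.fundamentalCoweight j⟫_ℝ) : b.IsPos v := by
  refine (isPos_or_isPos_neg hv).resolve_right fun hneg => h.not_ge ?_
  simpa only [inner_neg_left, neg_nonneg] using hneg.inner_fundamentalCoweight_nonneg j

end FundamentalCoweights

section LongestElements

variable {b : P.SimpleRoots ℓ}

theorem simpleReflectionsOmitting_subset (j : Fin (ℓ + 1)) :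
    b.simpleReflectionsOmitting j ⊆ Set.range b.simpleReflection := by
  rintro _ ⟨k, -, rfl⟩
  exact ⟨k, rfl⟩

theorem isLongestElement_inv {j : Fin (ℓ + 1)} {w : P.weylGroup}
    (hw : IsLongestElement (b.simpleReflectionsOmitting j) w) :
    IsLongestElement (b.simpleReflectionsOmitting j) w⁻¹ :=
  hw.inv (inv_mem_of_subset_range_simpleReflection (simpleReflectionsOmitting_subset j))

variable [P.IsEuclidean]

theorem smul_fundamentalCoweight_of_mem_closure {j : Fin (ℓ + 1)} {w : P.weylGroup}
    (hw : w ∈ Subgroup.closure (b.simpleReflectionsOmitting j)) :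
    w • b.fundamentalCoweight j = b.fundamentalCoweight j := by
  have hle : Subgroup.closure (b.simpleReflectionsOmitting j) ≤
      MulAction.stabilizer P.weylGroup (b.fundamentalCoweight j) := by
    rw [Subgroup.closure_le]
    rintro _ ⟨k, hk, rfl⟩
    rw [SetLike.mem_coe, MulAction.mem_stabilizer_iff, simpleReflection_smul,
      real_inner_comm (b.basis k) (b.fundamentalCoweight j), inner_basis_fundamentalCoweight,
      if_neg hk, mul_zero, zero_smul, sub_zero]
  exact hle hw

theorem isPos_neg_smul_basis_of_isLongestElement {j : Fin (ℓ + 1)} {w : P.weylGroup}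
    (hw : IsLongestElement (b.simpleReflectionsOmitting j) w) {k : Fin ℓ} (hk : k.succ ≠ j) :
    b.IsPos (-(w • b.basis k)) := by
  rw [isPos_neg_iff (weylGroup_smul_mem_range_root w (basis_mem_range_root k))]
  intro hpos
  have hmem : b.simpleReflection k ∈ b.simpleReflectionsOmitting j := ⟨k, hk, rfl⟩
  have hlt := wordLength_lt_mul_simpleReflection (simpleReflectionsOmitting_subset j) hw.1 hmem hpos
  exact hlt.not_ge (hw.2 _ (mul_mem hw.1 (Subgroup.subset_closure hmem)))

theorem IsPos.isPos_smul_iff_of_isLongestElement {j : Fin (ℓ + 1)} {w : P.weylGroup}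
    (hw : IsLongestElement (b.simpleReflectionsOmitting j) w) {v : E} (hv : b.IsPos v) :
    b.IsPos (w • v) ↔ 0 < ⟪v, b.fundamentalCoweight j⟫_ℝ := by
  have hwv := weylGroup_smul_mem_range_root w hv.1
  constructor
  · contrapose!
    intro hle
    have hsum : ∑ k, b.basis.repr v k * ⟪b.basis k, b.fundamentalCoweight j⟫_ℝ = 0 := by
      rw [← inner_eq_sum_repr]
      exact hle.antisymm (hv.inner_fundamentalCoweight_nonneg j)
    have hzero : ∀ k : Fin ℓ, k.succ = j → b.basis.repr v k = 0 := fun k hk => by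
      subst hk
      simpa [inner_basis_fundamentalCoweight] using hsum
    have hneg : -(w • v) = ∑ k, b.basis.repr v k • -(w • b.basis k) := by
      conv_lhs => rw [← b.basis.sum_repr v, Finset.smul_sum, ← Finset.sum_neg_distrib]
      simp only [smul_comm w, smul_neg]
    rw [← isPos_neg_iff hwv]
    refine ⟨P.neg_mem_range_root_iff.2 hwv, fun i => ?_⟩
    rw [hneg, map_sum, Finsupp.finsetSum_apply]
    refine Finset.sum_nonneg fun k _ => ?_
    rw [map_smul, Finsupp.smul_apply, smul_eq_mul]
    by_cases hk : k.succ = j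
    · rw [hzero k hk, zero_mul]
    · exact mul_nonneg (hv.2 k) ((isPos_neg_smul_basis_of_isLongestElement hw hk).2 i)
  · intro hlt
    refine isPos_of_inner_fundamentalCoweight_pos hwv (j := j) ?_
    rwa [← smul_fundamentalCoweight_of_mem_closure hw.1, P.inner_weylGroup_smul]

theorem isPos_smul_iff_not_isPos_of_isLongestElement {w : P.weylGroup}
    (hw : IsLongestElement (b.simpleReflectionsOmitting 0) w) {v : E}
    (hv : v ∈ Set.range P.root) : b.IsPos (w • v) ↔ ¬ b.IsPos v := by
  have hnot : ∀ {u}, b.IsPos u → ¬ b.IsPos (w • u) := fun hu => by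
    rw [hu.isPos_smul_iff_of_isLongestElement hw, inner_fundamentalCoweight_zero]
    exact lt_irrefl 0
  refine ⟨fun hwv hpos => hnot hpos hwv, fun hneg => ?_⟩
  have := hnot ((isPos_neg_iff hv).2 hneg)
  rwa [smul_neg, isPos_neg_iff (weylGroup_smul_mem_range_root w hv), not_not] at this

end LongestElements

section HighestRoot

variable (b : P.SimpleRoots ℓ)

/-- The root system has a highest root, i.e. `highestRoot` does dominate every root instead of being
the junk value `0`. -/
def HasHighestRoot : Prop :=
  ∀ k j, b.basis.repr (P.root k) j ≤ b.basis.repr b.highestRoot j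

/-- A maximal root for the order of the coefficients on the simple roots. -/
def IsMaximalRoot (i : ι) : Prop :=
  ∀ k, (∀ j, b.basis.repr (P.root i) j ≤ b.basis.repr (P.root k) j) → k = i

theorem exists_isMaximalRoot_ge [Finite ι] (k : ι) :
    ∃ i, b.IsMaximalRoot i ∧ ∀ j, b.basis.repr (P.root k) j ≤ b.basis.repr (P.root i) j := by
  let coeff : ι → Fin ℓ → ℝ := fun i j => b.basis.repr (P.root i) j
  have hcoeff : Function.Injective coeff := fun i i' h =>
    P.root.injective (b.basis.ext_elem fun j => congrFun h j)
  obtain ⟨_, hle, ⟨i, rfl⟩, hi⟩ := (Set.finite_range coeff).exists_le_maximal ⟨k, rfl⟩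
  exact ⟨i, fun k' hk' => hcoeff (le_antisymm (hi ⟨k', rfl⟩ hk') hk'), hle⟩

variable {b}

theorem IsMaximalRoot.isPos {i : ι} (hi : b.IsMaximalRoot i) : b.IsPos (P.root i) := by
  refine (isPos_or_isPos_neg ⟨i, rfl⟩).elim id fun hneg => ?_
  obtain ⟨k, hk⟩ := hneg.1
  rw [← hk] at hneg
  have hki : k = i := hi k fun j => by
    have hj := hneg.2 j
    rw [hk, map_neg, Finsupp.neg_apply] at hj ⊢
    linarith
  exact hki ▸ hneg

variable [P.IsEuclidean]

theorem inner_basis_nonpos {i k : Fin ℓ} (h : i ≠ k) : ⟪b.basis i, b.basis k⟫_ℝ ≤ 0 := by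
  have hpos : b.IsPos (b.simpleReflection k • b.basis i) := by
    refine isPos_of_repr_pos (weylGroup_smul_mem_range_root _ (basis_mem_range_root i))
      (j := i) ?_
    rw [repr_simpleReflection_smul_of_ne h]
    simp
  have hk := hpos.2 k
  rw [repr_simpleReflection_smul_self, Module.Basis.repr_self, Finsupp.single_eq_of_ne h.symm,
    zero_sub, Left.nonneg_neg_iff] at hk
  exact nonpos_of_mul_nonpos_right hk (two_div_inner_basis_self_pos k)

theorem IsMaximalRoot.inner_basis_nonneg {i : ι} (hi : b.IsMaximalRoot i) (k : Fin ℓ) :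
    0 ≤ ⟪P.root i, b.basis k⟫_ℝ := by
  by_contra! h
  have hcoeff : 2 / ⟪b.basis k, b.basis k⟫_ℝ * ⟪P.root i, b.basis k⟫_ℝ < 0 :=
    mul_neg_of_pos_of_neg (two_div_inner_basis_self_pos k) h
  obtain ⟨m, hm⟩ := weylGroup_smul_mem_range_root (b.simpleReflection k) ⟨i, rfl⟩
  have hmi : m = i := hi m fun j => by
    rw [hm]
    rcases eq_or_ne j k with rfl | hj
    · rw [repr_simpleReflection_smul_self]
      linarith
    · rw [repr_simpleReflection_smul_of_ne hj]
  have hrepr := repr_simpleReflection_smul_self (b := b) k (P.root i)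
  rw [← hm, hmi] at hrepr
  linarith

theorem smul_mem_of_forall_simpleReflection_smul_mem {q : Submodule ℝ E}
    (hq : ∀ k, ∀ x ∈ q, b.simpleReflection k • x ∈ q) (w : P.weylGroup) :
    ∀ x ∈ q, w • x ∈ q := by
  have hw : w ∈ Subgroup.closure (Set.range b.simpleReflection) := by
    rw [closure_range_simpleReflection]
    exact Subgroup.mem_top w
  induction hw using Subgroup.closure_induction'' with
  | one => simp only [one_smul, imp_self, implies_true]
  | mem _ h => obtain ⟨k, rfl⟩ := h; exact hq k
  | inv_mem _ h => obtain ⟨k, rfl⟩ := h; rw [inv_ofIdx]; exact hq k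
  | mul v w _ _ hv hw => exact fun x hx => mul_smul v w x ▸ hv _ (hw _ hx)

/-- The Dynkin diagram of an irreducible root system is connected. -/
theorem exists_inner_basis_ne_zero [P.IsIrreducible] {s : Set (Fin ℓ)} (hs : s.Nonempty)
    {k : Fin ℓ} (hk : k ∉ s) : ∃ j ∈ s, ∃ i ∉ s, ⟪b.basis j, b.basis i⟫_ℝ ≠ 0 := by
  by_contra! hort
  let q : Submodule ℝ E := Submodule.span ℝ (b.basis '' s)
  have hq : ∀ i, ∀ x ∈ q, b.simpleReflection i • x ∈ q := by
    intro i x hx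
    rw [simpleReflection_smul]
    by_cases hi : i ∈ s
    · exact q.sub_mem hx (q.smul_mem _ (Submodule.subset_span ⟨i, hi, rfl⟩))
    · have hle : q ≤ (innerₗ E (b.basis i)).ker := by
        rw [Submodule.span_le]
        rintro _ ⟨j, hj, rfl⟩
        exact (real_inner_comm _ _).trans (hort j hj i hi)
      have hxi : ⟪x, b.basis i⟫_ℝ = 0 := (real_inner_comm _ _).trans (hle hx)
      rwa [hxi, mul_zero, zero_smul, sub_zero]
  have htop : q = ⊤ := by
    refine IsIrreducible.eq_top_of_invtSubmodule_reflection (P := P) q (fun m x hx => ?_) ?_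
    · exact smul_mem_of_forall_simpleReflection_smul_mem hq (weylGroup.ofIdx P m) x hx
    · obtain ⟨j, hj⟩ := hs
      exact Submodule.ne_bot_iff q |>.2
        ⟨b.basis j, Submodule.subset_span ⟨j, hj, rfl⟩, b.basis.ne_zero j⟩
  exact hk (b.basis.self_mem_span_image.1 (htop ▸ Submodule.mem_top : b.basis k ∈ q))

theorem IsMaximalRoot.repr_pos [P.IsIrreducible] {i : ι} (hi : b.IsMaximalRoot i) (k : Fin ℓ) :
    0 < b.basis.repr (P.root i) k := by
  by_contra hk
  obtain ⟨j, hj, m, hm, hne⟩ := exists_inner_basis_ne_zero (b := b)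
    (s := {j | 0 < b.basis.repr (P.root i) j}) hi.isPos.exists_repr_pos hk
  have hm0 : b.basis.repr (P.root i) m = 0 := (not_lt.1 hm).antisymm (hi.isPos.2 m)
  have hjm : j ≠ m := fun h => hm (h ▸ hj)
  have hneg : ⟪P.root i, b.basis m⟫_ℝ < 0 := by
    rw [inner_eq_sum_repr (b := b)]
    refine Finset.sum_neg' (fun n _ => ?_) ⟨j, Finset.mem_univ j,
      mul_neg_of_pos_of_neg hj ((inner_basis_nonpos hjm).lt_of_ne hne)⟩
    rcases eq_or_ne n m with rfl | hn
    · rw [hm0, zero_mul]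
    · exact mul_nonpos_of_nonneg_of_nonpos (hi.isPos.2 n) (inner_basis_nonpos hn)
  exact hneg.not_ge (hi.inner_basis_nonneg m)

theorem IsMaximalRoot.unique [Finite ι] [P.IsCrystallographic] [P.IsIrreducible] {i i' : ι}
    (hi : b.IsMaximalRoot i) (hi' : b.IsMaximalRoot i') : i = i' := by
  by_contra hne
  have hinner : 0 < ⟪P.root i, P.root i'⟫_ℝ := by
    obtain ⟨k, hk⟩ := hi'.isPos.exists_inner_basis_pos
    rw [inner_eq_sum_repr (b := b)]
    refine Finset.sum_pos' (fun j _ => mul_nonneg (hi.isPos.2 j) ?_)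
      ⟨k, Finset.mem_univ k, mul_pos (hi.repr_pos k) ?_⟩
    · exact real_inner_comm (b.basis j) _ ▸ hi'.inner_basis_nonneg j
    · rwa [real_inner_comm]
  have hpairing : 0 < P.pairingIn ℤ i i' := by
    rw [← @Int.cast_pos ℝ, ← eq_intCast (algebraMap ℤ ℝ), P.algebraMap_pairingIn,
      IsEuclidean.pairing_eq_inner]
    exact mul_pos (div_pos two_pos (real_inner_self_pos.2 (P.ne_zero i'))) hinner
  rcases isPos_or_isPos_neg (b := b) (P.root_sub_root_mem_of_pairingIn_pos hpairing hne) with h | h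
  · refine hne (hi' i fun j => ?_)
    simpa using h.2 j
  · refine hne (hi i' fun j => ?_).symm
    simpa using h.2 j

theorem hasHighestRoot_of_isIrreducible [Finite ι] [P.IsCrystallographic] [P.IsIrreducible]
    (b : P.SimpleRoots ℓ) : b.HasHighestRoot := by
  intro k
  have hexists : ∃ i, ∀ k j, b.basis.repr (P.root k) j ≤ b.basis.repr (P.root i) j := by
    obtain ⟨i, hi, -⟩ := b.exists_isMaximalRoot_ge k
    refine ⟨i, fun k => ?_⟩
    obtain ⟨i', hi', hle⟩ := b.exists_isMaximalRoot_ge k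
    rwa [hi'.unique hi] at hle
  rw [highestRoot, dif_pos hexists]
  exact hexists.choose_spec k

end HighestRoot

section Alcove

variable {b : P.SimpleRoots ℓ}

theorem HasHighestRoot.one_le_repr (hb : b.HasHighestRoot) (j : Fin ℓ) :
    1 ≤ b.basis.repr b.highestRoot j := by
  simpa [← b.basis_apply] using hb (b.idx j) j

theorem HasHighestRoot.eq_zero_or_isPos (hb : b.HasHighestRoot) :
    b.highestRoot = 0 ∨ b.IsPos b.highestRoot := by
  have hroot : b.highestRoot = 0 ∨ b.highestRoot ∈ Set.range P.root := by
    unfold highestRoot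
    split_ifs with h
    exacts [.inr ⟨_, rfl⟩, .inl rfl]
  exact hroot.imp_right fun h => ⟨h, fun j => zero_le_one.trans (hb.one_le_repr j)⟩

theorem HasHighestRoot.isPos (hb : b.HasHighestRoot) (k : Fin ℓ) : b.IsPos b.highestRoot := by
  refine hb.eq_zero_or_isPos.resolve_left fun h => one_pos.not_ge (α := ℝ) ?_
  simpa only [h, map_zero, Finsupp.zero_apply] using hb.one_le_repr k

theorem HasHighestRoot.inner_le (hb : b.HasHighestRoot) {v x : E} (hv : b.IsPos v)
    (hx : ∀ j, 0 ≤ ⟪b.basis j, x⟫_ℝ) : ⟪v, x⟫_ℝ ≤ ⟪b.highestRoot, x⟫_ℝ := by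
  obtain ⟨⟨i, rfl⟩, -⟩ := hv
  rw [inner_eq_sum_repr (b := b), inner_eq_sum_repr (b := b) b.highestRoot]
  exact Finset.sum_le_sum fun j _ => mul_le_mul_of_nonneg_right (hb i j) (hx j)

theorem HasHighestRoot.mem_fundamentalAlcove_iff (hb : b.HasHighestRoot) {x : E} :
    x ∈ b.fundamentalAlcove ↔ ∀ v, b.IsPos v → ⟪v, x⟫_ℝ ∈ Set.Ioo 0 1 := by
  refine ⟨fun hx v hv => ⟨hv.inner_pos hx.1, (hb.inner_le hv fun j => (hx.1 j).le).trans_lt hx.2⟩,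
    fun h => ⟨fun j => (h _ (isPos_basis j)).1, ?_⟩⟩
  rcases hb.eq_zero_or_isPos with h0 | hpos
  · rw [h0, inner_zero_left]
    exact one_pos
  · exact (h _ hpos).2

theorem HasHighestRoot.nonempty_fundamentalAlcove (hb : b.HasHighestRoot) :
    b.fundamentalAlcove.Nonempty := by
  let s := ∑ j, b.basis.repr b.highestRoot j
  have hs : 0 ≤ s := Finset.sum_nonneg fun j _ => zero_le_one.trans (hb.one_le_repr j)
  obtain ⟨x, hx⟩ := b.exists_inner_basis fun _ => (s + 1)⁻¹
  refine ⟨x, fun j => ?_, ?_⟩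
  · rw [hx]
    positivity
  · rw [inner_eq_sum_repr (b := b)]
    simp only [hx]
    rw [← Finset.sum_mul, ← div_eq_mul_inv, div_lt_one (by positivity)]
    exact lt_add_one s

theorem HasHighestRoot.fundamentalAlcove_subset_parallelepiped (hb : b.HasHighestRoot) :
    b.fundamentalAlcove ⊆ b.parallelepiped := fun _ hx j =>
  have hxj := hb.mem_fundamentalAlcove_iff.1 hx _ (isPos_basis j)
  ⟨hxj.1, hxj.2.le⟩

/-- The coefficients of the roots are integers bounded by those of the highest root. -/
theorem HasHighestRoot.finite (hb : b.HasHighestRoot) : Finite ι := by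
  choose n hn using fun i : ι => exists_int_repr (b := b) ⟨i, rfl⟩
  have hle : ∀ i j, n i j ≤ ⌊b.basis.repr b.highestRoot j⌋ := fun i j =>
    Int.le_floor.2 (hn i j ▸ hb i j)
  have hge : ∀ i j, -⌊b.basis.repr b.highestRoot j⌋ ≤ n i j := fun i j => by
    obtain ⟨k, hk⟩ := P.neg_mem_range_root_iff.2 ⟨i, rfl⟩
    have hkn : n k j = -n i j := by
      rw [← @Int.cast_inj ℝ, ← hn, hk, map_neg, Finsupp.neg_apply, hn, Int.cast_neg]
    exact neg_le.1 (hkn ▸ hle k j)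
  have hinj : Function.Injective n := fun i k h =>
    P.root.injective (b.basis.ext_elem fun j => by rw [hn, hn, h])
  exact Finite.of_injective
    (fun i => (⟨n i, hge i, hle i⟩ :
      Set.Icc (fun j => -⌊b.basis.repr b.highestRoot j⌋) fun j => ⌊b.basis.repr b.highestRoot j⌋))
    fun i k h => hinj (congrArg Subtype.val h)

end Alcove

section AlcoveStabilizer

variable (b : P.SimpleRoots ℓ)

/-- `z` pairs to `1` with the positive roots that `w⁻¹` makes negative and to `0` with the other
positive roots. This is the numerical form of `w A_∘ + z = A_∘`. -/
def IsInversionCoweight (w : P.weylGroup) (z : E) : Prop :=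
  ∀ v, b.IsPos v → (b.IsPos (w⁻¹ • v) → ⟪v, z⟫_ℝ = 0) ∧ (¬ b.IsPos (w⁻¹ • v) → ⟪v, z⟫_ℝ = 1)

variable {b}

theorem IsInversionCoweight.inner_eq_zero_or_one {w : P.weylGroup} {z v : E}
    (hz : b.IsInversionCoweight w z) (hv : b.IsPos v) : ⟪v, z⟫_ℝ = 0 ∨ ⟪v, z⟫_ℝ = 1 :=
  (em _).imp (hz v hv).1 (hz v hv).2

theorem IsInversionCoweight.isPos_iff {w : P.weylGroup} {z v : E}
    (hz : b.IsInversionCoweight w z) (hv : b.IsPos v) : b.IsPos (w⁻¹ • v) ↔ ⟪v, z⟫_ℝ = 0 :=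
  ⟨(hz v hv).1, fun h => by_contra fun hneg => zero_ne_one (h.symm.trans ((hz v hv).2 hneg))⟩

theorem IsInversionCoweight.mem_coweightLattice {w : P.weylGroup} {z : E}
    (hz : b.IsInversionCoweight w z) : z ∈ P.coweightLattice :=
  b.mem_coweightLattice_of_basis fun j => (hz.inner_eq_zero_or_one (isPos_basis j)).elim
    (fun h => ⟨0, by rw [h, Int.cast_zero]⟩) fun h => ⟨1, by rw [h, Int.cast_one]⟩

variable [P.IsEuclidean]

theorem IsInversionCoweight.unique {v w : P.weylGroup} {z : E} (hv : b.IsInversionCoweight v z)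
    (hw : b.IsInversionCoweight w z) : v = w :=
  inv_injective <| eq_of_forall_isPos_smul_iff (b := b) fun _ hx =>
    (hv.isPos_iff hx).trans (hw.isPos_iff hx).symm

theorem HasHighestRoot.smul_add_mem_fundamentalAlcove_iff (hb : b.HasHighestRoot)
    {w : P.weylGroup} {x z : E} (hx : x ∈ b.fundamentalAlcove) (hz : z ∈ P.coweightLattice) :
    w • x + z ∈ b.fundamentalAlcove ↔ b.IsInversionCoweight w z := by
  rw [hb.mem_fundamentalAlcove_iff] at hx ⊢
  refine forall₂_congr fun v hv => ?_
  have hwv := weylGroup_smul_mem_range_root w⁻¹ hv.1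
  obtain ⟨m, hm⟩ : ∃ m : ℤ, ⟪v, z⟫_ℝ = m := by
    obtain ⟨i, rfl⟩ := hv.1
    exact hz i
  rw [inner_add_right, IsEuclidean.inner_weylGroup_smul_right, hm]
  by_cases hpos : b.IsPos (w⁻¹ • v)
  · rw [add_intCast_mem_Ioo_zero_one_iff (hx _ hpos)]
    simp [hpos]
  · have hneg := hx _ ((isPos_neg_iff hwv).2 hpos)
    have h1 : 1 - ⟪-(w⁻¹ • v), x⟫_ℝ ∈ Set.Ioo 0 1 := by
      constructor <;> linarith [hneg.1, hneg.2]
    have heq : ⟪w⁻¹ • v, x⟫_ℝ + m = 1 - ⟪-(w⁻¹ • v), x⟫_ℝ + (m - 1 : ℤ) := by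
      rw [inner_neg_left]
      push_cast
      ring
    rw [heq, add_intCast_mem_Ioo_zero_one_iff h1, sub_eq_zero]
    simp [hpos]

theorem HasHighestRoot.extended_smul_mem_fundamentalAlcove_iff (hb : b.HasHighestRoot)
    {g : P.ExtendedAffineWeylGroup} {x : E} (hx : x ∈ b.fundamentalAlcove) :
    g • x ∈ b.fundamentalAlcove ↔
      b.IsInversionCoweight g.right (Multiplicative.toAdd g.left : P.coweightLattice) :=
  hb.smul_add_mem_fundamentalAlcove_iff hx (Multiplicative.toAdd g.left : P.coweightLattice).2

theorem HasHighestRoot.isBlock_fundamentalAlcove (hb : b.HasHighestRoot) :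
    MulAction.IsBlock P.ExtendedAffineWeylGroup b.fundamentalAlcove := by
  have hmem : ∀ (g : P.ExtendedAffineWeylGroup) (x y : E), x ∈ b.fundamentalAlcove →
      g • x ∈ b.fundamentalAlcove → y ∈ b.fundamentalAlcove → g • y ∈ b.fundamentalAlcove :=
    fun g x y hx hgx hy => (hb.extended_smul_mem_fundamentalAlcove_iff hy).2
      ((hb.extended_smul_mem_fundamentalAlcove_iff hx).1 hgx)
  refine MulAction.isBlock_iff_smul_eq_of_mem.2 fun g x hx hgx =>
    Set.Subset.antisymm ?_ fun y hy => ?_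
  · rintro _ ⟨y, hy, rfl⟩
    exact hmem g x y hx hgx hy
  · rw [Set.mem_smul_set_iff_inv_smul_mem]
    exact hmem g⁻¹ (g • x) y hgx (by rwa [inv_smul_smul]) hy

theorem HasHighestRoot.mem_map_stabilizer_iff (hb : b.HasHighestRoot) {w : P.weylGroup} :
    w ∈ (MulAction.stabilizer P.ExtendedAffineWeylGroup b.fundamentalAlcove).map P.projWeyl ↔
      ∃ z, b.IsInversionCoweight w z := by
  obtain ⟨x, hx⟩ := hb.nonempty_fundamentalAlcove
  rw [Subgroup.mem_map]
  constructor
  · rintro ⟨g, hg, rfl⟩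
    refine ⟨_, (hb.extended_smul_mem_fundamentalAlcove_iff hx).1 ?_⟩
    exact (MulAction.mem_stabilizer_iff.1 hg).subset (Set.smul_mem_smul_set hx)
  · rintro ⟨z, hz⟩
    let g : P.ExtendedAffineWeylGroup := ⟨Multiplicative.ofAdd ⟨z, hz.mem_coweightLattice⟩, w⟩
    have hgx : g • x ∈ b.fundamentalAlcove := (hb.extended_smul_mem_fundamentalAlcove_iff hx).2 hz
    exact ⟨g, hb.isBlock_fundamentalAlcove.smul_eq_of_mem hx hgx, rfl⟩

end AlcoveStabilizer

section Omega

variable {b : P.SimpleRoots ℓ}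

theorem HasHighestRoot.inner_fundamentalCoweight_eq_zero_or_one (hb : b.HasHighestRoot)
    {j : Fin (ℓ + 1)} (hj : j ∈ b.J) {v : E} (hv : b.IsPos v) :
    ⟪v, b.fundamentalCoweight j⟫_ℝ = 0 ∨ ⟪v, b.fundamentalCoweight j⟫_ℝ = 1 := by
  induction j using Fin.cases with
  | zero => exact .inl (inner_fundamentalCoweight_zero v)
  | succ k =>
    rw [inner_fundamentalCoweight_succ]
    have hk : b.basis.repr b.highestRoot k = 1 := hj
    have hle : b.basis.repr v k ≤ 1 := by
      obtain ⟨⟨i, rfl⟩, -⟩ := hv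
      exact hk ▸ hb i k
    have hge := hv.2 k
    obtain ⟨n, hn⟩ := exists_int_repr hv.1 k
    rw [hn] at hle hge ⊢
    norm_cast at hle hge ⊢
    lia

theorem HasHighestRoot.exists_eq_fundamentalCoweight (hb : b.HasHighestRoot) {z : E}
    (hz : ∀ v, b.IsPos v → ⟪v, z⟫_ℝ = 0 ∨ ⟪v, z⟫_ℝ = 1) :
    ∃ j ∈ b.J, z = b.fundamentalCoweight j := by
  have hbasis i := hz _ (isPos_basis i)
  have hnonneg : ∀ i, 0 ≤ ⟪b.basis i, z⟫_ℝ := fun i => by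
    rcases hbasis i with h | h <;> simp [h]
  by_cases hex : ∃ k, ⟪b.basis k, z⟫_ℝ = 1
  · obtain ⟨k, hk⟩ := hex
    let r i := b.basis.repr b.highestRoot i * ⟪b.basis i, z⟫_ℝ
    have hr : ∀ i, ⟪b.basis i, z⟫_ℝ ≤ r i := fun i =>
      le_mul_of_one_le_left (hnonneg i) (hb.one_le_repr i)
    have hrk : r k = b.basis.repr b.highestRoot k := by simp only [r, hk, mul_one]
    have hr0 : ∀ i ∈ Finset.univ, 0 ≤ r i := fun i _ => (hnonneg i).trans (hr i)
    have hsum : ∑ i, r i ≤ 1 := by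
      rw [← inner_eq_sum_repr]
      rcases hz _ (hb.isPos k) with h | h <;> simp [h]
    refine ⟨k.succ, ?_, eq_fundamentalCoweight fun i => ?_⟩
    · have hle := (Finset.single_le_sum hr0 (Finset.mem_univ k)).trans hsum
      exact (hrk ▸ hle).antisymm (hb.one_le_repr k)
    · split_ifs with hik
      · rw [Fin.succ_inj.1 hik, hk]
      · have hle := (Finset.add_le_sum hr0 (Finset.mem_univ i) (Finset.mem_univ k)
          fun h => hik (h ▸ rfl)).trans hsum
        linarith [hr i, hr k, hnonneg i]
  · refine ⟨0, rfl, eq_fundamentalCoweight fun i => ?_⟩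
    rw [if_neg (Fin.succ_ne_zero i)]
    exact (hbasis i).resolve_right fun h => hex ⟨i, h⟩

variable [P.IsEuclidean]

theorem HasHighestRoot.isInversionCoweight_fundamentalCoweight (hb : b.HasHighestRoot)
    {j : Fin (ℓ + 1)} (hj : j ∈ b.J) {wj w0 : P.weylGroup}
    (hwj : IsLongestElement (b.simpleReflectionsOmitting j) wj)
    (hw0 : IsLongestElement (b.simpleReflectionsOmitting 0) w0) :
    b.IsInversionCoweight (wj * w0) (b.fundamentalCoweight j) := by
  intro v hv
  have hiff : b.IsPos ((wj * w0)⁻¹ • v) ↔ ⟪v, b.fundamentalCoweight j⟫_ℝ ≤ 0 := by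
    rw [mul_inv_rev, mul_smul, isPos_smul_iff_not_isPos_of_isLongestElement
      (isLongestElement_inv hw0) (weylGroup_smul_mem_range_root _ hv.1),
      hv.isPos_smul_iff_of_isLongestElement (isLongestElement_inv hwj), not_lt]
  rw [hiff]
  rcases hb.inner_fundamentalCoweight_eq_zero_or_one hj hv with h | h <;> simp [h]

theorem HasHighestRoot.mem_Omega_iff (hb : b.HasHighestRoot) {w : P.weylGroup} :
    w ∈ b.Omega ↔ ∃ z, b.IsInversionCoweight w z := by
  constructor
  · rintro ⟨j, hj, wj, w0, hwj, hw0, rfl⟩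
    exact ⟨_, hb.isInversionCoweight_fundamentalCoweight hj hwj hw0⟩
  · rintro ⟨z, hz⟩
    have := hb.finite
    have := b.finite_weylGroup
    obtain ⟨j, hj, rfl⟩ := hb.exists_eq_fundamentalCoweight fun _ => hz.inner_eq_zero_or_one
    obtain ⟨wj, hwj⟩ := exists_isLongestElement (b.simpleReflectionsOmitting j)
    obtain ⟨w0, hw0⟩ := exists_isLongestElement (b.simpleReflectionsOmitting 0)
    exact ⟨j, hj, wj, w0, hwj, hw0,
      hz.unique (hb.isInversionCoweight_fundamentalCoweight hj hwj hw0)⟩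

end Omega

section Torus

variable {b : P.SimpleRoots ℓ} [P.IsEuclidean]

theorem toTorus_extended_smul (g : P.ExtendedAffineWeylGroup) (x : E) :
    P.toTorus (g • x) = g.right • P.toTorus x := by
  refine QuotientAddGroup.eq.2 ?_
  change -(g.right • x + ((Multiplicative.toAdd g.left : P.coweightLattice) : E)) + g.right • x ∈ _
  rw [neg_add_rev, neg_add_cancel_right]
  exact neg_mem (Multiplicative.toAdd g.left : P.coweightLattice).2

theorem stabilizer_image_toTorus {C : Set E} (hne : C.Nonempty)
    (hC : MulAction.IsBlock P.ExtendedAffineWeylGroup C) :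
    MulAction.stabilizer P.weylGroup (P.toTorus '' C) =
      (MulAction.stabilizer P.ExtendedAffineWeylGroup C).map P.projWeyl := by
  ext w
  rw [MulAction.mem_stabilizer_iff, Subgroup.mem_map]
  constructor
  · intro h
    obtain ⟨x, hx⟩ := hne
    obtain ⟨y, hy, hyx⟩ : w • P.toTorus x ∈ P.toTorus '' C :=
      h ▸ Set.smul_mem_smul_set ⟨x, hx, rfl⟩
    have hz : -(w • x) + y ∈ P.coweightLattice := QuotientAddGroup.eq.1 hyx.symm
    let g : P.ExtendedAffineWeylGroup := ⟨Multiplicative.ofAdd ⟨_, hz⟩, w⟩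
    have hgx : g • x = y := add_neg_cancel_left (w • x) y
    exact ⟨g, hC.smul_eq_of_mem hx (hgx ▸ hy), rfl⟩
  · rintro ⟨g, hg, rfl⟩
    calc P.projWeyl g • P.toTorus '' C
        = P.toTorus '' (g • C) := by
          simp only [← Set.image_smul, Set.image_image]
          exact Set.image_congr fun x _ => (toTorus_extended_smul g x).symm
      _ = P.toTorus '' C := by rw [MulAction.mem_stabilizer_iff.1 hg]

theorem stabilizer_eq_stabilizer_image_toTorus {C : Set E} (hC : C ⊆ b.parallelepiped) :
    b.stabilizer C = MulAction.stabilizer P.weylGroup (P.toTorus '' C) := by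
  ext w
  let C' : Set b.parallelepiped := {x | (x : E) ∈ C}
  have hval : Subtype.val '' C' = C := by
    rw [show C' = Subtype.val ⁻¹' C from rfl, Subtype.image_preimage_coe]
    exact Set.inter_eq_right.2 hC
  have htorus : P.toTorus '' C = b.parallelepipedEquiv '' C' := by
    conv_lhs => rw [← hval, Set.image_image]
    rfl
  have hrho : (fun x : b.parallelepiped => (b.rho w x : E)) '' C' =
      Subtype.val '' (b.parallelepipedEquiv.symm '' (w • b.parallelepipedEquiv '' C')) := by
    simp only [← Set.image_smul, Set.image_image]
    rfl
  calc w ∈ b.stabilizer C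
      ↔ Subtype.val '' (b.parallelepipedEquiv.symm '' (w • b.parallelepipedEquiv '' C')) =
          Subtype.val '' C' := by rw [← hrho, hval]; rfl
    _ ↔ b.parallelepipedEquiv.symm '' (w • b.parallelepipedEquiv '' C') =
          b.parallelepipedEquiv.symm '' (b.parallelepipedEquiv '' C') := by
        rw [Set.image_eq_image Subtype.val_injective, Equiv.symm_image_image]
    _ ↔ w ∈ MulAction.stabilizer P.weylGroup (P.toTorus '' C) := by
        rw [Set.image_eq_image b.parallelepipedEquiv.symm.injective, htorus,
          MulAction.mem_stabilizer_iff]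

end Torus

end RootPairing.SimpleRoots

theorem proposition4p6_general {ι E : Type*} [NormedAddCommGroup E] [InnerProductSpace ℝ E]
    {P : RootPairing ι ℝ E E} [P.IsEuclidean] {ℓ : ℕ} {b : P.SimpleRoots ℓ}
    (hb : b.HasHighestRoot) :
    b.stabilizer b.fundamentalAlcove = b.Omega ∧
    (MulAction.stabilizer P.weylGroup (P.toTorus '' b.fundamentalAlcove) : Set P.weylGroup) =
      b.Omega ∧
    ((MulAction.stabilizer P.ExtendedAffineWeylGroup b.fundamentalAlcove).map P.projWeyl :
      Set P.weylGroup) = b.Omega := by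
  have hmap : ((MulAction.stabilizer P.ExtendedAffineWeylGroup b.fundamentalAlcove).map
      P.projWeyl : Set P.weylGroup) = b.Omega :=
    Set.ext fun _ => hb.mem_map_stabilizer_iff.trans hb.mem_Omega_iff.symm
  have htorus : (MulAction.stabilizer P.weylGroup (P.toTorus '' b.fundamentalAlcove) :
      Set P.weylGroup) = b.Omega := by
    rw [RootPairing.SimpleRoots.stabilizer_image_toTorus hb.nonempty_fundamentalAlcove
      hb.isBlock_fundamentalAlcove, hmap]
  refine ⟨?_, htorus, hmap⟩
  rw [RootPairing.SimpleRoots.stabilizer_eq_stabilizer_image_toTorus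
    hb.fundamentalAlcove_subset_parallelepiped, htorus]

theorem proposition4p6 {ι E : Type*} [Finite ι] [NormedAddCommGroup E] [InnerProductSpace ℝ E]
    (P : RootPairing ι ℝ E E) [P.IsRootSystem] [P.IsCrystallographic] [P.IsEuclidean]
    (hirr : P.IsIrreducible ∨ IsEmpty ι) {ℓ : ℕ} (b : P.SimpleRoots ℓ) :
    b.stabilizer b.fundamentalAlcove = b.Omega ∧
    (MulAction.stabilizer P.weylGroup (P.toTorus '' b.fundamentalAlcove) : Set P.weylGroup) =
      b.Omega ∧
    ((MulAction.stabilizer P.ExtendedAffineWeylGroup b.fundamentalAlcove).map P.projWeyl :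
      Set P.weylGroup) = b.Omega :=
  proposition4p6_general <| hirr.elim (fun _ => b.hasHighestRoot_of_isIrreducible)
    fun _ => isEmptyElim
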